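/- Let $n\ge 0$ and let $\mathbf U=(U_1,\dots,U_n)$ be a random vector with nonnegative components which is non-degenerate, i.e. its covariance matrix exists (each $U_i$ has finite second moment) and has full rank. Let $\mathbf Y=\mathcal P(\mathbf U)$ be the output of the vector Poisson channel with input $\mathbf U$: $\mathbf Y$ takes values in $\mathbb Z_+^n$ and, given $\mathbf U=\boldsymbol u$, its components are independent with $$P(\mathbf Y=\boldsymbol y\mid \mathbf U=\boldsymbol u)=\prod_{i=1}^n \frac{u_i^{y_i}e^{-u_i}}{y_i!},\qquad \boldsymbol y\in\mathbb Z_+^n \quad(0^0=1).$$ Then there exist a matrix $\mathsf H\in\mathbb R^{n\times n}$ and a vector $\boldsymbol c\in\mathbb R^n$ such that $$\mathbb E[\mathbf U\mid \mathbf Y=\boldsymbol y]=\mathsf H\boldsymbol y+\boldsymbol c\quad\text{for all }\boldsymbol y\in\mathbb Z^n_+\text{ with }P(\mathbf Y=\boldsymbol y)>0$$ if and only if there exist $\theta_i>0$, $\alpha_i>0$ ($1\le i\le n$) such that the law of $\mathbf U$ is the product $\prod_{i=1}^n \mathsf{Gam}(\theta_i,\alpha_i)$, where $\mathsf{Gam}(\theta,\alpha)$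 denotes the gamma distribution with rate $\theta$ and shape $\alpha$, whose density is $\frac{\theta^{\alpha}}{\Gamma(\alpha)}x^{\alpha-1}e^{-\theta x}$, $x\ge 0$. In this case, for any such $\mathsf H,\boldsymbol c,\theta_i,\alpha_i$, one has $P(\mathbf Y=\boldsymbol y)>0$ for every $\boldsymbol y\in\mathbb Z_+^n$ (so the affine formula holds for all $\boldsymbol y\in\mathbb Z^n_+$), the matrix $\mathsf H$ is diagonal with entries $h_{ii}=\frac{1}{1+\theta_i}$, and $c_i=\alpha_i h_{ii}=\frac{\alpha_i}{1+\theta_i}$; in particular $0<h_{ii}<1$ and $c_i>0$ for all $i$. -/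

import Mathlib

open MeasureTheory ProbabilityTheory

noncomputable section

namespace PoissonLinear

/-- The vector Poisson channel: for an input `u` with nonnegative entries, the output entries are
independent and the `i`-th one is Poisson with mean `u i`. -/
def poissonChannel (n : ℕ) : Kernel (Fin n → ℝ) (Fin n → ℕ) where
  toFun u := Measure.pi fun i => poissonMeasure (u i).toNNReal
  measurable' := by
    refine Measure.measurable_of_measurable_coe _ fun s _ => ?_
    have h : ∀ u : Fin n → ℝ, (Measure.pi fun i => poissonMeasure (u i).toNNReal) s =
        ∑' y : s, ∏ i, ENNReal.ofReal (Real.exp (-((u i).toNNReal : ℝ)) *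
          ((u i).toNNReal : ℝ) ^ ((y : Fin n → ℕ) i) / ((y : Fin n → ℕ) i).factorial) := by
      intro u
      rw [← Measure.tsum_indicator_apply_singleton _ s (Set.to_countable s).measurableSet,
        ← tsum_subtype s]
      refine tsum_congr fun y => ?_
      rw [Measure.pi_singleton]
      simp only [poissonMeasure_singleton]
    simp_rw [h]
    fun_prop

instance (n : ℕ) : IsMarkovKernel (poissonChannel n) :=
  ⟨fun u => inferInstanceAs
    (IsProbabilityMeasure (Measure.pi fun i => poissonMeasure (u i).toNNReal))⟩

variable {Ω : Type*} [MeasurableSpace Ω] {n : ℕ}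

/-- `Y` is the output of the Poisson channel with input `U`: the conditional law of `Y` given
`U = u` is `poissonChannel n u`. -/
def IsPoissonOutput (P : Measure Ω) (U : Ω → Fin n → ℝ) (Y : Ω → Fin n → ℕ) : Prop :=
  Measurable Y ∧ HasCondDistrib Y U (poissonChannel n) P

/-- The covariance matrix of the random vector `U`. -/
def covMatrix (P : Measure Ω) (U : Ω → Fin n → ℝ) : Matrix (Fin n) (Fin n) ℝ :=
  Matrix.of fun i j => covariance (fun ω => U ω i) (fun ω => U ω j) P

/-- `U` is non-degenerate: its covariance matrix exists and has full rank. -/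
def IsNondegenerate (P : Measure Ω) (U : Ω → Fin n → ℝ) : Prop :=
  (∀ i, MemLp (fun ω => U ω i) 2 P) ∧ (covMatrix P U).rank = n

/-- The conditional mean `E[U | Y = y]`, meaningful for those `y` with `P(Y = y) > 0`. -/
def condMean (P : Measure Ω) (U : Ω → Fin n → ℝ) (Y : Ω → Fin n → ℕ) (y : Fin n → ℕ) :
    Fin n → ℝ :=
  fun i => ∫ ω, U ω i ∂(ProbabilityTheory.cond P (Y ⁻¹' {y}))

/-- `E[U | Y = y] = H y + c` for all `y` at which the conditional mean is defined. -/
def HasAffineCondMean (P : Measure Ω) (U : Ω → Fin n → ℝ) (Y : Ω → Fin n → ℕ)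
    (H : Matrix (Fin n) (Fin n) ℝ) (c : Fin n → ℝ) : Prop :=
  ∀ y : Fin n → ℕ, P (Y ⁻¹' {y}) ≠ 0 →
    condMean P U Y y = H.mulVec (fun j => (y j : ℝ)) + c

/-- The law of `U` is the product over `i` of the gamma distributions with
rate `θ i > 0` and shape `α i > 0`. -/
def HasProductGammaLaw (P : Measure Ω) (U : Ω → Fin n → ℝ) (θ α : Fin n → ℝ) : Prop :=
  (∀ i, 0 < θ i ∧ 0 < α i) ∧
    P.map U = Measure.pi fun i => gammaMeasure (α i) (θ i)

end PoissonLinear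

end

/-! Let `μ` be the law of `U` and `m(y) = ∫ ∏ u_i^{y_i} e^{-u_i} dμ`. Then `P(Y = y) = m(y)/y!` and
`E[U_i | Y = y] = m(y + e_i)/m(y)`, so an affine conditional mean amounts to the recursion `m(y +
e_i) = ((Hy)_i + c_i) m(y)` (`hasAffineCondMean_iff`). The recursion fixes `m` up to the factor
`m(0)`. Since `e^{-∑ u_i} dμ` has exponential moments, `m` up to scale determines `μ`
(`ext_of_tiltedMoment`). Products of gamma laws satisfy the recursion with `H = diag(1/(1 + θ_i))`
and `c_i = α_i/(1 + θ_i)`.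

It remains to show that every admissible `(H, c)` has this form. Computing `m(y + e_i + e_j)` in
both orders gives `H_ji (row i) = H_ij (row j)`; the rows of `H` are independent by non-degeneracy
(`eq_zero_of_vecMul_eq_zero`), so `H` is diagonal. Positivity of `m(k e_i)` gives `c_i, H_ii > 0`,
and `H_ii < 1` because the sum of `m(k e_i)/k!` is at most 1, whereas `H_ii ≥ 1` would make it
dominate a harmonic series. -/

noncomputable section

namespace PoissonLinear

open Filter Topology

/-! ### Moment determinacy under exponential moments -/

/-- Two random variables with exponential moments near `0` and equal moments have the same
characteristic function at `1`. -/
lemma complexMGF_I_eq_of_moments_eq {Ω Ω' : Type*} [MeasurableSpace Ω] [MeasurableSpace Ω']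
    {μ : Measure Ω} {μ' : Measure Ω'} {X : Ω → ℝ} {Y : Ω' → ℝ}
    (hX : 0 ∈ interior (integrableExpSet X μ)) (hY : 0 ∈ interior (integrableExpSet Y μ'))
    (h : ∀ k : ℕ, ∫ ω, X ω ^ k ∂μ = ∫ ω, Y ω ^ k ∂μ') :
    complexMGF X μ Complex.I = complexMGF Y μ' Complex.I := by
  have hXa : AnalyticAt ℂ (complexMGF X μ) 0 := analyticAt_complexMGF (by simpa using hX)
  have hYa : AnalyticAt ℂ (complexMGF Y μ') 0 := analyticAt_complexMGF (by simpa using hY)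
  have hser : ∀ k : ℕ, iteratedDeriv k (complexMGF X μ) 0 = iteratedDeriv k (complexMGF Y μ') 0 := by
    intro k
    rw [iteratedDeriv_complexMGF (by simpa using hX), iteratedDeriv_complexMGF (by simpa using hY)]
    simp only [zero_mul, Complex.exp_zero, mul_one]
    have := congrArg (fun x : ℝ => (x : ℂ)) (h k)
    simpa only [← integral_complex_ofReal, Complex.ofReal_pow] using this
  have hev : complexMGF X μ =ᶠ[𝓝 0] complexMGF Y μ' := by
    have h1 := hXa.hasFPowerSeriesAt
    have h2 := hYa.hasFPowerSeriesAt
    simp only [hser] at h1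
    filter_upwards [h1.eventually_hasSum_sub, h2.eventually_hasSum_sub] with z hz1 hz2
    exact hz1.unique hz2
  -- A vertical strip, convex and hence connected, on which both functions are analytic. It contains
  -- `0`, where the Taylor series agree, and `I`.
  let S : Set ℂ := {z | z.re ∈ interior (integrableExpSet X μ) ∩ interior (integrableExpSet Y μ')}
  have hS : IsPreconnected S :=
    ((convex_integrableExpSet.interior.inter convex_integrableExpSet.interior).linear_preimage
      Complex.reLm).isPreconnected
  refine AnalyticOnNhd.eqOn_of_preconnected_of_eventuallyEq (U := S) (z₀ := 0)
    (fun z hz => analyticAt_complexMGF hz.1) (fun z hz => analyticAt_complexMGF hz.2) hS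
    (by simpa [S] using ⟨hX, hY⟩) hev (by simpa [S] using ⟨hX, hY⟩)

variable {n : ℕ}

lemma abs_prod_pow_le (u : Fin n → ℝ) (y : Fin n → ℕ) :
    |∏ i, u i ^ y i| ≤ (∏ i, ((y i).factorial : ℝ)) * Real.exp (∑ i, |u i|) := by
  rw [Real.exp_sum, ← Finset.prod_mul_distrib, Finset.abs_prod]
  refine Finset.prod_le_prod (fun i _ => abs_nonneg _) fun i _ => ?_
  have h := Real.pow_div_factorial_le_exp _ (abs_nonneg (u i)) (y i)
  rw [div_le_iff₀ (by positivity)] at h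
  rw [abs_pow]
  linarith

lemma integrable_prod_pow {ν : Measure (Fin n → ℝ)}
    (hν : Integrable (fun u => Real.exp (∑ i, |u i|)) ν) (y : Fin n → ℕ) :
    Integrable (fun u : Fin n → ℝ => ∏ i, u i ^ y i) ν := by
  refine (hν.const_mul (∏ i, ((y i).factorial : ℝ))).mono'
    (Measurable.aestronglyMeasurable (by fun_prop)) (ae_of_all _ fun u => abs_prod_pow_le u y)

lemma integral_eval_mvPolynomial {ν : Measure (Fin n → ℝ)}
    (hν : Integrable (fun u => Real.exp (∑ i, |u i|)) ν) (p : MvPolynomial (Fin n) ℝ) :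
    ∫ u, MvPolynomial.eval u p ∂ν = ∑ d ∈ p.support, p.coeff d * ∫ u, ∏ i, u i ^ d i ∂ν := by
  simp_rw [MvPolynomial.eval_eq']
  rw [integral_finsetSum]
  · simp_rw [integral_const_mul]
  · exact fun d _ => (integrable_prod_pow hν d).const_mul _

lemma zero_mem_interior_integrableExpSet {ν : Measure (Fin n → ℝ)}
    (hν : Integrable (fun u => Real.exp (∑ i, |u i|)) ν) (L : StrongDual ℝ (Fin n → ℝ)) :
    0 ∈ interior (integrableExpSet L ν) := by
  rw [mem_interior_iff_mem_nhds]
  -- The `+ 1` covers `L = 0`; the radius makes `|t * L u|` at most `∑ i, |u i|`.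
  have hpos : 0 < (‖L‖ + 1)⁻¹ := by positivity
  refine Filter.mem_of_superset (Metric.ball_mem_nhds 0 hpos) fun t ht => ?_
  rw [mem_ball_zero_iff, Real.norm_eq_abs] at ht
  refine hν.mono' (by fun_prop) (ae_of_all _ fun u => ?_)
  rw [Real.norm_eq_abs, Real.abs_exp]
  refine Real.exp_le_exp.2 ?_
  have h1 : |L u| ≤ ‖L‖ * ∑ i, |u i| := by
    refine (L.le_opNorm u).trans ?_
    gcongr
    refine (pi_norm_le_iff_of_nonneg (Finset.sum_nonneg fun _ _ => abs_nonneg _)).2 fun i => ?_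
    exact Finset.single_le_sum (f := fun i => |u i|) (fun _ _ => abs_nonneg _) (Finset.mem_univ i)
  have hs : 0 ≤ ∑ i, |u i| := Finset.sum_nonneg fun _ _ => abs_nonneg _
  calc t * L u ≤ |t| * |L u| := by rw [← abs_mul]; exact le_abs_self _
    _ ≤ (‖L‖ + 1)⁻¹ * ((‖L‖ + 1) * ∑ i, |u i|) := by
        gcongr
        nlinarith
    _ = ∑ i, |u i| := by field_simp

/-- Moment determinacy: finite measures with exponential moments are determined by their mixed
moments. -/
lemma ext_of_mixed_moments {ν ν' : Measure (Fin n → ℝ)} [IsFiniteMeasure ν] [IsFiniteMeasure ν']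
    (hν : Integrable (fun u => Real.exp (∑ i, |u i|)) ν)
    (hν' : Integrable (fun u => Real.exp (∑ i, |u i|)) ν')
    (h : ∀ y : Fin n → ℕ, ∫ u, ∏ i, u i ^ y i ∂ν = ∫ u, ∏ i, u i ^ y i ∂ν') : ν = ν' := by
  refine Measure.ext_of_charFunDual (funext fun L => ?_)
  have key := complexMGF_I_eq_of_moments_eq (zero_mem_interior_integrableExpSet hν L)
    (zero_mem_interior_integrableExpSet hν' L) fun k => ?_
  · simpa only [charFunDual_apply, complexMGF, mul_comm Complex.I] using key
  · let p : MvPolynomial (Fin n) ℝ :=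
      (∑ i, MvPolynomial.C (L (Pi.single i 1)) * MvPolynomial.X i) ^ k
    have hp : ∀ u, L u ^ k = MvPolynomial.eval u p := by
      intro u
      have : L u = ∑ i, L (Pi.single i 1) * u i := by
        conv_lhs => rw [pi_eq_sum_univ' u, map_sum]
        refine Finset.sum_congr rfl fun i _ => ?_
        rw [map_smul, smul_eq_mul, mul_comm]
      simp [p, this]
    simp_rw [hp]
    rw [integral_eval_mvPolynomial hν, integral_eval_mvPolynomial hν']
    exact Finset.sum_congr rfl fun d _ => by rw [h]

/-! ### Tilted moments -/

/-- The moment of order `y` of the measure `exp (-∑ i, u i) dμ`. -/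
def tiltedMoment (μ : Measure (Fin n → ℝ)) (y : Fin n → ℕ) : ℝ :=
  ∫ u, ∏ i, (u i ^ y i * Real.exp (-u i)) ∂μ

/-- For `u ≥ 0` the bound `u^k e^{-u} ≤ k!` makes the weight bounded, so `μ` needs no moments of its
own. -/
lemma integrable_tilted_weight {μ : Measure (Fin n → ℝ)} [IsFiniteMeasure μ]
    (h0 : ∀ᵐ u ∂μ, ∀ i, 0 ≤ u i) (y : Fin n → ℕ) :
    Integrable (fun u : Fin n → ℝ => ∏ i, (u i ^ y i * Real.exp (-u i))) μ := by
  refine Integrable.of_bound (by fun_prop) (∏ i, ((y i).factorial : ℝ)) ?_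
  filter_upwards [h0] with u hu
  rw [Real.norm_eq_abs, Finset.prod_mul_distrib, abs_mul, ← Real.exp_sum, Real.abs_exp]
  have h := abs_prod_pow_le u y
  simp_rw [abs_of_nonneg (hu _)] at h
  calc _ ≤ (∏ i, ((y i).factorial : ℝ)) * Real.exp (∑ i, u i) * Real.exp (∑ i, -u i) := by gcongr
    _ = _ := by rw [mul_assoc, ← Real.exp_add]; simp

lemma tiltedMoment_zero_pos (μ : Measure (Fin n → ℝ)) [IsProbabilityMeasure μ]
    (h0 : ∀ᵐ u ∂μ, ∀ i, 0 ≤ u i) : 0 < tiltedMoment μ 0 := by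
  have hi := integrable_tilted_weight h0 0
  simp only [tiltedMoment, Pi.zero_apply, pow_zero, one_mul, ← Real.exp_sum] at hi ⊢
  exact integral_exp_pos hi

lemma integrable_exp_tilted {μ : Measure (Fin n → ℝ)} [IsFiniteMeasure μ]
    (h0 : ∀ᵐ u ∂μ, ∀ i, 0 ≤ u i) :
    Integrable (fun u => Real.exp (∑ i, |u i|)) (μ.tilted fun u => -∑ i, u i) := by
  have hexp : Integrable (fun u : Fin n → ℝ => Real.exp (-∑ i, u i)) μ := by
    simpa [← Real.exp_sum] using integrable_tilted_weight h0 0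
  rw [integrable_tilted_iff hexp]
  refine (integrable_const (1 : ℝ)).congr ?_
  filter_upwards [h0] with u hu
  simp_rw [abs_of_nonneg (hu _)]
  rw [smul_eq_mul, ← Real.exp_add]
  simp

lemma integral_tilted_eq_tiltedMoment {μ : Measure (Fin n → ℝ)} (y : Fin n → ℕ) :
    ∫ u, ∏ i, u i ^ y i ∂(μ.tilted fun u => -∑ i, u i) = tiltedMoment μ y / tiltedMoment μ 0 := by
  rw [integral_tilted]
  simp_rw [tiltedMoment, smul_eq_mul, Finset.prod_mul_distrib, ← Real.exp_sum,
    Finset.sum_neg_distrib]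
  rw [← integral_div]
  refine integral_congr_ae (ae_of_all _ fun u => ?_)
  simp
  ring

/-- A probability measure on the nonnegative orthant is determined by its tilted moments up to a
constant. -/
lemma ext_of_tiltedMoment {μ μ' : Measure (Fin n → ℝ)} [IsProbabilityMeasure μ]
    [IsProbabilityMeasure μ'] (h0 : ∀ᵐ u ∂μ, ∀ i, 0 ≤ u i) (h0' : ∀ᵐ u ∂μ', ∀ i, 0 ≤ u i)
    (h : ∀ y, tiltedMoment μ y / tiltedMoment μ 0 = tiltedMoment μ' y / tiltedMoment μ' 0) :
    μ = μ' := by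
  have hexp : ∀ {ρ : Measure (Fin n → ℝ)} [IsProbabilityMeasure ρ], (∀ᵐ u ∂ρ, ∀ i, 0 ≤ u i) →
      Integrable (fun u => Real.exp (-∑ i, u i)) ρ := fun h => by
    simpa [← Real.exp_sum] using integrable_tilted_weight h 0
  have key : (μ.tilted fun u => -∑ i, u i) = μ'.tilted fun u => -∑ i, u i := by
    refine ext_of_mixed_moments (integrable_exp_tilted h0) (integrable_exp_tilted h0') fun y => ?_
    rw [integral_tilted_eq_tiltedMoment, integral_tilted_eq_tiltedMoment, h]
  rw [← tilted_neg_same (hexp h0), key, tilted_neg_same (hexp h0')]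

/-! ### Gamma laws on the line -/

lemma measurable_gammaPDF (a r : ℝ) : Measurable (gammaPDF a r) :=
  (measurable_gammaPDFReal a r).ennreal_ofReal

lemma ae_nonneg_gammaMeasure (a r : ℝ) : ∀ᵐ x ∂gammaMeasure a r, 0 ≤ x := by
  rw [gammaMeasure, ae_withDensity_iff (measurable_gammaPDF a r)]
  refine ae_of_all _ fun x hx => ?_
  by_contra h
  exact hx (gammaPDF_of_neg (not_le.1 h))

/-- The moments of the measure `exp (-x) dGam(r, a)`. -/
lemma integral_pow_mul_exp_neg_gammaMeasure {a r : ℝ} (ha : 0 < a) (hr : 0 < r) (k : ℕ) :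
    ∫ x, x ^ k * Real.exp (-x) ∂gammaMeasure a r =
      r ^ a / Real.Gamma a * ((1 / (1 + r)) ^ (a + k) * Real.Gamma (a + k)) := by
  rw [gammaMeasure, integral_withDensity_eq_integral_toReal_smul
    (measurable_gammaPDF a r) (ae_of_all _ fun x => ENNReal.ofReal_lt_top)]
  have h1 : ∀ x, (gammaPDF a r x).toReal • (x ^ k * Real.exp (-x)) =
      (Set.Ici (0 : ℝ)).indicator (fun x => r ^ a / Real.Gamma a * x ^ (a - 1) *
        Real.exp (-(r * x)) * (x ^ k * Real.exp (-x))) x := by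
    intro x
    rw [gammaPDF, ENNReal.toReal_ofReal (gammaPDFReal_nonneg ha hr x), gammaPDFReal, smul_eq_mul]
    by_cases hx : 0 ≤ x <;> simp [hx]
  simp_rw [h1]
  rw [integral_indicator measurableSet_Ici, integral_Ici_eq_integral_Ioi,
    ← Real.integral_rpow_mul_exp_neg_mul_Ioi (by positivity) (by positivity), ← integral_const_mul]
  refine setIntegral_congr_fun measurableSet_Ioi fun x hx => ?_
  have hx : 0 < x := hx
  have h2 : x ^ (a + k - 1) = x ^ (a - 1) * x ^ k := by
    rw [← Real.rpow_natCast, ← Real.rpow_add hx]; ring_nf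
  have h3 : Real.exp (-((1 + r) * x)) = Real.exp (-(r * x)) * Real.exp (-x) := by
    rw [← Real.exp_add]; ring_nf
  simp only [h2, h3]
  ring

lemma integral_pow_mul_exp_neg_gammaMeasure_pos {a r : ℝ} (ha : 0 < a) (hr : 0 < r) (k : ℕ) :
    0 < ∫ x, x ^ k * Real.exp (-x) ∂gammaMeasure a r := by
  rw [integral_pow_mul_exp_neg_gammaMeasure ha hr]
  positivity

lemma integral_pow_succ_mul_exp_neg_gammaMeasure {a r : ℝ} (ha : 0 < a) (hr : 0 < r) (k : ℕ) :
    ∫ x, x ^ (k + 1) * Real.exp (-x) ∂gammaMeasure a r =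
      (a + k) / (1 + r) * ∫ x, x ^ k * Real.exp (-x) ∂gammaMeasure a r := by
  rw [integral_pow_mul_exp_neg_gammaMeasure ha hr, integral_pow_mul_exp_neg_gammaMeasure ha hr]
  push_cast
  rw [← add_assoc, Real.Gamma_add_one (by positivity), Real.rpow_add_one (by positivity)]
  ring

/-! ### Unit shifts of the multi-index -/

lemma prod_add_single {M : Type*} [CommMonoid M] (f : Fin n → ℕ → M) (y : Fin n → ℕ) (i : Fin n)
    {a : M} (h : f i (y i + 1) = a * f i (y i)) :
    ∏ j, f j ((y + Pi.single i 1 : Fin n → ℕ) j) = a * ∏ j, f j (y j) := by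
  rw [← Finset.mul_prod_erase _ _ (Finset.mem_univ i),
    ← Finset.mul_prod_erase Finset.univ (fun j => f j (y j)) (Finset.mem_univ i), ← mul_assoc, ← h]
  congr 1
  · simp
  · refine Finset.prod_congr rfl fun j hj => ?_
    simp [Pi.single_eq_of_ne (Finset.ne_of_mem_erase hj)]

lemma tiltedWeight_add_single (u : Fin n → ℝ) (y : Fin n → ℕ) (i : Fin n) :
    ∏ j, (u j ^ (y + Pi.single i 1 : Fin n → ℕ) j * Real.exp (-u j)) =
      u i * ∏ j, (u j ^ y j * Real.exp (-u j)) :=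
  prod_add_single (fun j k => u j ^ k * Real.exp (-u j)) y i (by ring)

lemma tiltedMoment_add_single (μ : Measure (Fin n → ℝ)) (y : Fin n → ℕ) (i : Fin n) :
    tiltedMoment μ (y + Pi.single i 1) = ∫ u, u i * ∏ j, (u j ^ y j * Real.exp (-u j)) ∂μ := by
  simp_rw [tiltedMoment, tiltedWeight_add_single]

/-! ### Products of gamma laws -/

section ProductGamma

variable {θ α : Fin n → ℝ}

lemma isProbabilityMeasure_pi_gamma (h : ∀ i, 0 < θ i ∧ 0 < α i) :
    IsProbabilityMeasure (Measure.pi fun i => gammaMeasure (α i) (θ i)) := by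
  have := fun i => isProbabilityMeasure_gammaMeasure (h i).2 (h i).1
  infer_instance

lemma ae_nonneg_pi_gamma (h : ∀ i, 0 < θ i ∧ 0 < α i) :
    ∀ᵐ u ∂(Measure.pi fun i => gammaMeasure (α i) (θ i)), ∀ i, 0 ≤ u i := by
  have := fun i => isProbabilityMeasure_gammaMeasure (h i).2 (h i).1
  exact ae_all_iff.2 fun i =>
    (Measure.quasiMeasurePreserving_eval _ i).ae (ae_nonneg_gammaMeasure (α i) (θ i))

lemma tiltedMoment_pi_gamma (h : ∀ i, 0 < θ i ∧ 0 < α i) (y : Fin n → ℕ) :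
    tiltedMoment (Measure.pi fun i => gammaMeasure (α i) (θ i)) y =
      ∏ i, ∫ x, x ^ y i * Real.exp (-x) ∂gammaMeasure (α i) (θ i) := by
  have := fun i => isProbabilityMeasure_gammaMeasure (h i).2 (h i).1
  exact integral_fintype_prod_eq_prod (𝕜 := ℝ) fun i x => x ^ y i * Real.exp (-x)

lemma tiltedMoment_pi_gamma_pos (h : ∀ i, 0 < θ i ∧ 0 < α i) (y : Fin n → ℕ) :
    0 < tiltedMoment (Measure.pi fun i => gammaMeasure (α i) (θ i)) y := by
  rw [tiltedMoment_pi_gamma h]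
  exact Finset.prod_pos fun i _ => integral_pow_mul_exp_neg_gammaMeasure_pos (h i).2 (h i).1 _

lemma tiltedMoment_pi_gamma_add_single (h : ∀ i, 0 < θ i ∧ 0 < α i) (y : Fin n → ℕ) (i : Fin n) :
    tiltedMoment (Measure.pi fun i => gammaMeasure (α i) (θ i)) (y + Pi.single i 1) =
      (α i + y i) / (1 + θ i) * tiltedMoment (Measure.pi fun i => gammaMeasure (α i) (θ i)) y := by
  rw [tiltedMoment_pi_gamma h, tiltedMoment_pi_gamma h]
  exact prod_add_single (fun j k => ∫ x, x ^ k * Real.exp (-x) ∂gammaMeasure (α j) (θ j)) y i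
    (integral_pow_succ_mul_exp_neg_gammaMeasure (h i).2 (h i).1 _)

end ProductGamma

/-! ### Output probabilities and conditional means of the channel -/

section Channel

variable {Ω : Type*} [MeasurableSpace Ω] {P : Measure Ω} [IsProbabilityMeasure P]
  {U : Ω → Fin n → ℝ} {Y : Ω → Fin n → ℕ}

lemma poissonChannel_real_singleton {u : Fin n → ℝ} (hu : ∀ i, 0 ≤ u i) (y : Fin n → ℕ) :
    (poissonChannel n u).real {y} =
      (∏ i, (u i ^ y i * Real.exp (-u i))) / ∏ i, ((y i).factorial : ℝ) := by
  change (Measure.pi fun i => poissonMeasure (u i).toNNReal).real {y} = _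
  rw [measureReal_def, Measure.pi_singleton, ENNReal.toReal_prod, ← Finset.prod_div_distrib]
  refine Finset.prod_congr rfl fun i _ => ?_
  rw [poissonMeasure_singleton, ENNReal.toReal_ofReal (by positivity), Real.coe_toNNReal _ (hu i)]
  ring

/-- Disintegrating the joint law of `(U, Y)` along `U` replaces the event `Y = y` by its Poisson
likelihood. The choices `f = 1` and `f u = u i` give the two ingredients of the conditional mean. -/
lemma setIntegral_output_eq (hU : Measurable U) (hU0 : ∀ᵐ ω ∂P, ∀ i, 0 ≤ U ω i)
    (hY : IsPoissonOutput P U Y) {f : (Fin n → ℝ) → ℝ} (hf : Measurable f)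
    (hfi : Integrable (fun ω => f (U ω)) P) (y : Fin n → ℕ) :
    ∫ ω in Y ⁻¹' {y}, f (U ω) ∂P =
      (∫ u, f u * ∏ i, (u i ^ y i * Real.exp (-u i)) ∂(P.map U)) /
        ∏ i, ((y i).factorial : ℝ) := by
  have hpair : Measurable fun ω => (U ω, Y ω) := hU.prodMk hY.1
  have hmap := hY.2.map_eq
  have : IsProbabilityMeasure (P.map U) := Measure.isProbabilityMeasure_map hU.aemeasurable
  have hfm : Measurable fun p : (Fin n → ℝ) × (Fin n → ℕ) => f p.1 := hf.comp measurable_fst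
  have hs : MeasurableSet ((Set.univ : Set (Fin n → ℝ)) ×ˢ ({y} : Set (Fin n → ℕ))) :=
    MeasurableSet.univ.prod (measurableSet_singleton y)
  have h0 : ∀ᵐ u ∂(P.map U), ∀ i, 0 ≤ u i :=
    (ae_map_iff hU.aemeasurable (by measurability)).2 hU0
  have h1 : ∫ ω in Y ⁻¹' {y}, f (U ω) ∂P =
      ∫ p in Set.univ ×ˢ {y}, f p.1 ∂(P.map U ⊗ₘ poissonChannel n) := by
    rw [← hmap, setIntegral_map hs hfm.aestronglyMeasurable
      hpair.aemeasurable]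
    simp [Set.preimage, Set.mem_prod]
  have hint : Integrable (fun p : (Fin n → ℝ) × (Fin n → ℕ) => f p.1)
      (P.map U ⊗ₘ poissonChannel n) := by
    rw [← hmap, integrable_map_measure hfm.aestronglyMeasurable
      hpair.aemeasurable]
    exact hfi
  rw [h1, Measure.setIntegral_compProd MeasurableSet.univ (measurableSet_singleton y)
    hint.integrableOn, setIntegral_univ, ← integral_div]
  refine integral_congr_ae ?_
  filter_upwards [h0] with u hu
  rw [setIntegral_const, smul_eq_mul, poissonChannel_real_singleton hu]
  ring

lemma prob_output_eq (hU : Measurable U) (hU0 : ∀ᵐ ω ∂P, ∀ i, 0 ≤ U ω i)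
    (hY : IsPoissonOutput P U Y) (y : Fin n → ℕ) :
    P.real (Y ⁻¹' {y}) = tiltedMoment (P.map U) y / ∏ i, ((y i).factorial : ℝ) := by
  have h := setIntegral_output_eq hU hU0 hY (f := fun _ => 1) measurable_const
    (integrable_const _) y
  simpa [tiltedMoment] using h

lemma prob_output_ne_zero_iff (hU : Measurable U) (hU0 : ∀ᵐ ω ∂P, ∀ i, 0 ≤ U ω i)
    (hY : IsPoissonOutput P U Y) (y : Fin n → ℕ) :
    P (Y ⁻¹' {y}) ≠ 0 ↔ tiltedMoment (P.map U) y ≠ 0 := by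
  rw [← measureReal_ne_zero_iff, prob_output_eq hU hU0 hY, div_ne_zero_iff]
  exact and_iff_left (Finset.prod_ne_zero_iff.2 fun i _ => by positivity)

lemma condMean_eq (hU : Measurable U) (hU0 : ∀ᵐ ω ∂P, ∀ i, 0 ≤ U ω i)
    (hY : IsPoissonOutput P U Y) (hint : ∀ i, Integrable (fun ω => U ω i) P)
    (y : Fin n → ℕ) (i : Fin n) :
    condMean P U Y y i =
      tiltedMoment (P.map U) (y + Pi.single i 1) / tiltedMoment (P.map U) y := by
  have h := setIntegral_output_eq hU hU0 hY (f := fun u => u i) (measurable_pi_apply i) (hint i) y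
  rw [condMean, ProbabilityTheory.cond, integral_smul_measure, h, ENNReal.toReal_inv,
    ← measureReal_def, prob_output_eq hU hU0 hY, tiltedMoment_add_single, smul_eq_mul]
  have : (∏ i, ((y i).factorial : ℝ)) ≠ 0 := Finset.prod_ne_zero_iff.2 fun i _ => by positivity
  field_simp

lemma tiltedWeight_nonneg {u : Fin n → ℝ} (hu : ∀ i, 0 ≤ u i) (y : Fin n → ℕ) :
    0 ≤ ∏ i, (u i ^ y i * Real.exp (-u i)) :=
  Finset.prod_nonneg fun i _ => mul_nonneg (pow_nonneg (hu i) _) (Real.exp_pos _).le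

lemma tiltedMoment_eq_zero_iff {μ : Measure (Fin n → ℝ)} [IsFiniteMeasure μ]
    (h0 : ∀ᵐ u ∂μ, ∀ i, 0 ≤ u i) (y : Fin n → ℕ) :
    tiltedMoment μ y = 0 ↔ ∀ᵐ u ∂μ, ∏ i, (u i ^ y i * Real.exp (-u i)) = 0 :=
  integral_eq_zero_iff_of_nonneg_ae (h0.mono fun _ hu => tiltedWeight_nonneg hu y)
    (integrable_tilted_weight h0 y)

/-- Lets the recursion hold trivially where `P(Y = y) = 0`, so that it can be stated for every `y`.
-/
lemma tiltedMoment_add_single_eq_zero {μ : Measure (Fin n → ℝ)} [IsFiniteMeasure μ]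
    (h0 : ∀ᵐ u ∂μ, ∀ i, 0 ≤ u i) {y : Fin n → ℕ} (hy : tiltedMoment μ y = 0) (i : Fin n) :
    tiltedMoment μ (y + Pi.single i 1) = 0 := by
  rw [tiltedMoment_eq_zero_iff h0] at hy ⊢
  filter_upwards [hy] with u hu
  rw [tiltedWeight_add_single, hu, mul_zero]

/-- Affinity of the conditional mean is a first order recursion for the tilted moments of the
input law. -/
lemma hasAffineCondMean_iff (hU : Measurable U) (hU0 : ∀ᵐ ω ∂P, ∀ i, 0 ≤ U ω i)
    (hY : IsPoissonOutput P U Y) (hint : ∀ i, Integrable (fun ω => U ω i) P)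
    (H : Matrix (Fin n) (Fin n) ℝ) (c : Fin n → ℝ) :
    HasAffineCondMean P U Y H c ↔ ∀ y i, tiltedMoment (P.map U) (y + Pi.single i 1) =
      (H.mulVec (fun j => (y j : ℝ)) i + c i) * tiltedMoment (P.map U) y := by
  have : IsProbabilityMeasure (P.map U) := Measure.isProbabilityMeasure_map hU.aemeasurable
  have h0 : ∀ᵐ u ∂(P.map U), ∀ i, 0 ≤ u i :=
    (ae_map_iff hU.aemeasurable (by measurability)).2 hU0
  constructor
  · intro h y i
    by_cases hy : tiltedMoment (P.map U) y = 0
    · rw [hy, mul_zero, tiltedMoment_add_single_eq_zero h0 hy]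
    · have := congrFun (h y ((prob_output_ne_zero_iff hU hU0 hY y).2 hy)) i
      rw [condMean_eq hU hU0 hY hint, div_eq_iff hy] at this
      exact this
  · intro h y hy
    rw [prob_output_ne_zero_iff hU hU0 hY] at hy
    ext i
    rw [condMean_eq hU hU0 hY hint, div_eq_iff hy, h]
    rfl

end Channel

/-! ### Non-degeneracy, and uniqueness for the recursion -/

/-- A non-degenerate random vector satisfies no nontrivial affine relation. -/
lemma IsNondegenerate.eq_zero_of_ae_const {Ω : Type*} [MeasurableSpace Ω] {P : Measure Ω}
    [IsProbabilityMeasure P] {U : Ω → Fin n → ℝ} (h : IsNondegenerate P U) {v : Fin n → ℝ} {k : ℝ}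
    (hv : ∀ᵐ ω ∂P, ∑ i, v i * U ω i = k) : v = 0 := by
  have hmul : (covMatrix P U).mulVec v = 0 := by
    ext i
    have h1 : cov[fun ω => U ω i, fun ω => ∑ j, v j * U ω j; P] = 0 := by
      have : cov[fun ω => U ω i, fun ω => ∑ j, v j * U ω j; P] =
          cov[fun ω => U ω i, fun _ => k; P] := by
        rw [covariance, covariance, integral_congr_ae hv]
        refine integral_congr_ae ?_
        filter_upwards [hv] with ω hω
        rw [hω]
      rw [this, covariance_const_right]
    rw [covariance_fun_sum_right (fun j => (h.1 j).const_mul (v j)) (h.1 i)] at h1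
    simp_rw [covariance_const_mul_right] at h1
    simpa [Matrix.mulVec, dotProduct, covMatrix, mul_comm] using h1
  have hrange : LinearMap.range (covMatrix P U).mulVecLin = ⊤ :=
    Submodule.eq_top_of_finrank_eq (by simpa [Matrix.rank] using h.2)
  exact LinearMap.injective_iff_surjective.2 (LinearMap.range_eq_top.1 hrange)
    (hmul.trans (map_zero (covMatrix P U).mulVecLin).symm)

/-- Tilted moments satisfying the same first order recursion agree up to normalization. -/
lemma tiltedMoment_div_eq_of_recursion {μ μ' : Measure (Fin n → ℝ)} {r : (Fin n → ℕ) → Fin n → ℝ}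
    (hμ0 : tiltedMoment μ 0 ≠ 0) (hμ0' : tiltedMoment μ' 0 ≠ 0)
    (h : ∀ y i, tiltedMoment μ (y + Pi.single i 1) = r y i * tiltedMoment μ y)
    (h' : ∀ y i, tiltedMoment μ' (y + Pi.single i 1) = r y i * tiltedMoment μ' y)
    (y : Fin n → ℕ) :
    tiltedMoment μ y / tiltedMoment μ 0 = tiltedMoment μ' y / tiltedMoment μ' 0 := by
  induction hN : ∑ i, y i generalizing y with
  | zero =>
    have : y = 0 := by
      ext i
      exact (Finset.sum_eq_zero_iff.1 hN) i (Finset.mem_univ i)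
    rw [this, div_self hμ0, div_self hμ0']
  | succ N ih =>
    obtain ⟨i, hi⟩ : ∃ i, y i ≠ 0 := by
      by_contra! hc
      simp [hc] at hN
    obtain ⟨z, rfl⟩ : ∃ z, y = z + Pi.single i 1 := by
      refine ⟨y - Pi.single i 1, (tsub_add_cancel_of_le ?_).symm⟩
      intro j
      by_cases hj : j = i
      · subst hj; simpa using Nat.one_le_iff_ne_zero.2 hi
      · simp [hj]
    rw [h, h', mul_div_assoc, mul_div_assoc, ih z (by simpa [Finset.sum_add_distrib] using hN)]

lemma single_recursion {μ : Measure (Fin n → ℝ)} {H : Matrix (Fin n) (Fin n) ℝ} {c : Fin n → ℝ}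
    (hd : ∀ y i, tiltedMoment μ (y + Pi.single i 1) =
      (H i i * y i + c i) * tiltedMoment μ y) (i : Fin n) (k : ℕ) :
    tiltedMoment μ (Pi.single i (k + 1)) =
      (H i i * k + c i) * tiltedMoment μ (Pi.single i k) := by
  have := hd (Pi.single i k) i
  rwa [← Pi.single_add, Pi.single_eq_same] at this

/-! ### Constraints on the coefficients of the recursion -/

section Recursion

variable {μ : Measure (Fin n → ℝ)} [IsProbabilityMeasure μ] {H : Matrix (Fin n) (Fin n) ℝ}
  {c : Fin n → ℝ}

/-- If it vanished, `u i = 0` almost everywhere, a forbidden affine relation. -/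
lemma tiltedMoment_single_pos (h0 : ∀ᵐ u ∂μ, ∀ i, 0 ≤ u i)
    (hnd : ∀ (v : Fin n → ℝ) (k : ℝ), (∀ᵐ u ∂μ, ∑ i, v i * u i = k) → v = 0) (i : Fin n) (k : ℕ) :
    0 < tiltedMoment μ (Pi.single i k) := by
  have hnonneg : 0 ≤ tiltedMoment μ (Pi.single i k) :=
    integral_nonneg_of_ae (h0.mono fun _ hu => tiltedWeight_nonneg hu _)
  refine lt_of_le_of_ne hnonneg fun h => ?_
  have hz := (tiltedMoment_eq_zero_iff h0 _).1 h.symm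
  have hv : Pi.single i (1 : ℝ) = (0 : Fin n → ℝ) := by
    refine hnd _ 0 ?_
    filter_upwards [hz] with u hu
    obtain ⟨j, -, hj⟩ := Finset.prod_eq_zero_iff.1 hu
    have hpow := (mul_eq_zero.1 hj).resolve_right (Real.exp_pos _).ne'
    by_cases hji : j = i
    · subst hji
      simpa [Pi.single_apply] using eq_zero_of_pow_eq_zero hpow
    · simp [hji] at hpow
  simpa using congrFun hv i

lemma integrable_affine_mul_weight (h0 : ∀ᵐ u ∂μ, ∀ i, 0 ≤ u i) (v : Fin n → ℝ) (k : ℝ)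
    (y : Fin n → ℕ) :
    Integrable (fun u => (∑ i, v i * u i - k) * ∏ j, (u j ^ y j * Real.exp (-u j))) μ := by
  have h1 : ∀ i, Integrable (fun u => v i * (u i * ∏ j, (u j ^ y j * Real.exp (-u j)))) μ := by
    intro i
    simp_rw [← tiltedWeight_add_single]
    exact (integrable_tilted_weight h0 _).const_mul _
  have h2 := (integrable_finsetSum Finset.univ fun i _ => h1 i).sub
    ((integrable_tilted_weight h0 y).const_mul k)
  refine h2.congr (ae_of_all _ fun u => ?_)
  simp only [Pi.sub_apply, sub_mul, Finset.sum_mul, mul_assoc]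

lemma integral_affine_mul_weight (h0 : ∀ᵐ u ∂μ, ∀ i, 0 ≤ u i) (v : Fin n → ℝ) (k : ℝ)
    (y : Fin n → ℕ) :
    ∫ u, (∑ i, v i * u i - k) * ∏ j, (u j ^ y j * Real.exp (-u j)) ∂μ =
      ∑ i, v i * tiltedMoment μ (y + Pi.single i 1) - k * tiltedMoment μ y := by
  have h1 : ∀ i, Integrable (fun u => v i * (u i * ∏ j, (u j ^ y j * Real.exp (-u j)))) μ := by
    intro i
    simp_rw [← tiltedWeight_add_single]
    exact (integrable_tilted_weight h0 _).const_mul _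
  simp_rw [sub_mul, Finset.sum_mul, mul_assoc]
  rw [integral_sub (integrable_finsetSum Finset.univ fun i _ => h1 i)
    ((integrable_tilted_weight h0 y).const_mul k), integral_finsetSum _ fun i _ => h1 i]
  simp_rw [integral_const_mul, tiltedMoment_add_single]
  rfl

/-- In the recursion for the tilted moments of a non-degenerate law, the matrix has linearly
independent rows. -/
lemma eq_zero_of_vecMul_eq_zero (h0 : ∀ᵐ u ∂μ, ∀ i, 0 ≤ u i)
    (hnd : ∀ (v : Fin n → ℝ) (k : ℝ), (∀ᵐ u ∂μ, ∑ i, v i * u i = k) → v = 0)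
    (hrec : ∀ y i, tiltedMoment μ (y + Pi.single i 1) =
      (H.mulVec (fun j => (y j : ℝ)) i + c i) * tiltedMoment μ y)
    {v : Fin n → ℝ} (hv : Matrix.vecMul v H = 0) : v = 0 := by
  set k := v ⬝ᵥ c with hk
  -- The affine function `v ⬝ u - v ⬝ c` is orthogonal to every monomial under the tilted measure.
  have horth : ∀ y : Fin n → ℕ,
      ∫ u, (∑ i, v i * u i - k) * ∏ j, (u j ^ y j * Real.exp (-u j)) ∂μ = 0 := by
    intro y
    have h1 : v ⬝ᵥ H.mulVec (fun j => (y j : ℝ)) = 0 := by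
      rw [Matrix.dotProduct_mulVec, hv, zero_dotProduct]
    rw [integral_affine_mul_weight h0]
    simp_rw [hrec]
    have h2 : ∑ i, v i * ((H.mulVec (fun j => (y j : ℝ)) i + c i) * tiltedMoment μ y) =
        (v ⬝ᵥ H.mulVec (fun j => (y j : ℝ)) + k) * tiltedMoment μ y := by
      rw [hk, ← dotProduct_add, dotProduct, Finset.sum_mul]
      simp only [Pi.add_apply, mul_assoc]
    rw [h2, h1]
    ring
  -- Being itself affine, it is orthogonal to itself; only the monomials of degree at most one are
  -- needed.
  have hexpand : ∀ u : Fin n → ℝ,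
      (∑ i, v i * u i - k) ^ 2 * ∏ j, (u j ^ (0 : Fin n → ℕ) j * Real.exp (-u j)) =
      ∑ i, v i * ((∑ i, v i * u i - k) *
        ∏ j, (u j ^ ((0 : Fin n → ℕ) + Pi.single i 1 : Fin n → ℕ) j * Real.exp (-u j))) -
      k * ((∑ i, v i * u i - k) * ∏ j, (u j ^ (0 : Fin n → ℕ) j * Real.exp (-u j))) := by
    intro u
    simp_rw [tiltedWeight_add_single]
    generalize ∏ j, (u j ^ (0 : Fin n → ℕ) j * Real.exp (-u j)) = w
    generalize hs : ∑ i, v i * u i = s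
    have : ∑ i, v i * ((s - k) * (u i * w)) = s * ((s - k) * w) := by
      conv_rhs => rw [← hs, Finset.sum_mul]
      refine Finset.sum_congr rfl fun i _ => ?_
      rw [hs]; ring
    rw [this]
    ring
  have hi := fun y => integrable_affine_mul_weight h0 v k y
  have hint : Integrable (fun u : Fin n → ℝ => (∑ i, v i * u i - k) ^ 2 *
      ∏ j, (u j ^ (0 : Fin n → ℕ) j * Real.exp (-u j))) μ := by
    simp_rw [hexpand]
    exact (integrable_finsetSum _ fun i _ => (hi _).const_mul _).sub ((hi 0).const_mul k)
  have hzero : ∫ u, (∑ i, v i * u i - k) ^ 2 *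
      ∏ j, (u j ^ (0 : Fin n → ℕ) j * Real.exp (-u j)) ∂μ = 0 := by
    simp_rw [hexpand]
    rw [integral_sub (integrable_finsetSum _ fun i _ => (hi _).const_mul _) ((hi 0).const_mul k),
      integral_finsetSum _ fun i _ => (hi _).const_mul _]
    simp_rw [integral_const_mul, horth]
    simp
  rw [integral_eq_zero_iff_of_nonneg_ae
    (h0.mono fun u hu => mul_nonneg (sq_nonneg _) (tiltedWeight_nonneg hu 0)) hint] at hzero
  refine hnd v k ?_
  filter_upwards [hzero] with u hu
  have hw : ∏ j, (u j ^ (0 : Fin n → ℕ) j * Real.exp (-u j)) ≠ 0 :=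
    Finset.prod_ne_zero_iff.2 fun j _ => by simp
  have := (mul_eq_zero.1 hu).resolve_right hw
  exact sub_eq_zero.1 (pow_eq_zero_iff two_ne_zero |>.1 this)

lemma const_pos_of_recursion (h0 : ∀ᵐ u ∂μ, ∀ i, 0 ≤ u i)
    (hnd : ∀ (v : Fin n → ℝ) (k : ℝ), (∀ᵐ u ∂μ, ∑ i, v i * u i = k) → v = 0)
    (hrec : ∀ y i, tiltedMoment μ (y + Pi.single i 1) =
      (H.mulVec (fun j => (y j : ℝ)) i + c i) * tiltedMoment μ y) (i : Fin n) : 0 < c i := by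
  have h1 := hrec 0 i
  have h2 := tiltedMoment_single_pos h0 hnd i 1
  have h3 : H.mulVec (fun j => (((0 : Fin n → ℕ) j : ℕ) : ℝ)) = 0 := by
    have : (fun j => (((0 : Fin n → ℕ) j : ℕ) : ℝ)) = 0 := by ext; simp
    rw [this, Matrix.mulVec_zero]
  rw [zero_add, h3, Pi.zero_apply, zero_add] at h1
  rw [h1] at h2
  exact pos_of_mul_pos_left h2 (tiltedMoment_zero_pos μ h0).le

lemma mulVec_natCast_add_single (H : Matrix (Fin n) (Fin n) ℝ) (y : Fin n → ℕ) (i j : Fin n) :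
    H.mulVec (fun l => (((y + Pi.single i 1 : Fin n → ℕ) l : ℕ) : ℝ)) j =
      H.mulVec (fun l => (y l : ℝ)) j + H j i := by
  have : (fun l => (((y + Pi.single i 1 : Fin n → ℕ) l : ℕ) : ℝ)) = (fun l => (y l : ℝ)) + Pi.single i 1 := by
    ext l
    by_cases h : l = i
    · subst h; simp
    · simp [h]
  rw [this, Matrix.mulVec_add]
  simp

/-- The matrix in the recursion for the tilted moments of a non-degenerate law is diagonal. -/
lemma offDiag_eq_zero_of_recursion (h0 : ∀ᵐ u ∂μ, ∀ i, 0 ≤ u i)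
    (hnd : ∀ (v : Fin n → ℝ) (k : ℝ), (∀ᵐ u ∂μ, ∑ i, v i * u i = k) → v = 0)
    (hrec : ∀ y i, tiltedMoment μ (y + Pi.single i 1) =
      (H.mulVec (fun j => (y j : ℝ)) i + c i) * tiltedMoment μ y) {i j : Fin n} (hij : i ≠ j) :
    H i j = 0 := by
  -- Compare the two orders of passing from `y` to `y + e_i + e_j`.
  have hsymm : ∀ y, tiltedMoment μ y ≠ 0 →
      H j i * (H.mulVec (fun l => (y l : ℝ)) i + c i) =
        H i j * (H.mulVec (fun l => (y l : ℝ)) j + c j) := by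
    intro y hy
    have h1 := hrec (y + Pi.single i 1) j
    have h2 := hrec (y + Pi.single j 1) i
    rw [add_right_comm, h2, mulVec_natCast_add_single, mulVec_natCast_add_single, hrec, hrec,
      ← mul_assoc, ← mul_assoc] at h1
    have h3 := mul_right_cancel₀ hy h1
    linarith
  have hconst := hsymm 0 (tiltedMoment_zero_pos μ h0).ne'
  have hrow : ∀ k, H j i * H i k = H i j * H j k := by
    intro k
    -- Subtracting the relation at `0` from the one at `e_k` isolates column `k`.
    have h1 := hsymm (0 + Pi.single k 1)
      (by rw [zero_add]; exact (tiltedMoment_single_pos h0 hnd k 1).ne')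
    rw [mulVec_natCast_add_single, mulVec_natCast_add_single] at h1
    linarith
  have hv := eq_zero_of_vecMul_eq_zero h0 hnd hrec
    (v := H j i • Pi.single i 1 - H i j • Pi.single j 1) (by
      ext k
      simp [Matrix.sub_vecMul, Matrix.smul_vecMul, hrow k])
  have := congrFun hv j
  simpa [hij.symm] using this

lemma diagonal_recursion (h0 : ∀ᵐ u ∂μ, ∀ i, 0 ≤ u i)
    (hnd : ∀ (v : Fin n → ℝ) (k : ℝ), (∀ᵐ u ∂μ, ∑ i, v i * u i = k) → v = 0)
    (hrec : ∀ y i, tiltedMoment μ (y + Pi.single i 1) =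
      (H.mulVec (fun j => (y j : ℝ)) i + c i) * tiltedMoment μ y) (y : Fin n → ℕ) (i : Fin n) :
    tiltedMoment μ (y + Pi.single i 1) = (H i i * y i + c i) * tiltedMoment μ y := by
  rw [hrec, Matrix.mulVec, dotProduct, Finset.sum_eq_single i]
  · intro j _ hj
    rw [offDiag_eq_zero_of_recursion h0 hnd hrec hj.symm, zero_mul]
  · simp

/-- Ratios of consecutive `m(k e_i)` are positive, so `H i i * k + c i > 0` for all `k`, which
excludes a negative slope. A zero slope would give `H` a zero row. -/
lemma diag_pos_of_recursion (h0 : ∀ᵐ u ∂μ, ∀ i, 0 ≤ u i)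
    (hnd : ∀ (v : Fin n → ℝ) (k : ℝ), (∀ᵐ u ∂μ, ∑ i, v i * u i = k) → v = 0)
    (hrec : ∀ y i, tiltedMoment μ (y + Pi.single i 1) =
      (H.mulVec (fun j => (y j : ℝ)) i + c i) * tiltedMoment μ y) (i : Fin n) : 0 < H i i := by
  have hd := diagonal_recursion h0 hnd hrec
  have hpos : ∀ k : ℕ, 0 < H i i * k + c i := by
    intro k
    have h1 := tiltedMoment_single_pos h0 hnd i (k + 1)
    rw [single_recursion hd] at h1
    exact pos_of_mul_pos_left h1 (tiltedMoment_single_pos h0 hnd i k).le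
  refine lt_of_le_of_ne ?_ fun h => ?_
  · by_contra! hneg
    obtain ⟨k, hk⟩ := exists_nat_gt (c i / -H i i)
    rw [div_lt_iff₀ (by linarith)] at hk
    have := hpos k
    linarith
  · have hv := eq_zero_of_vecMul_eq_zero h0 hnd hrec (v := Pi.single i 1) (by
      ext k
      by_cases hk : k = i
      · subst hk; simp [← h]
      · simp [offDiag_eq_zero_of_recursion h0 hnd hrec (Ne.symm hk)])
    simpa using congrFun hv i

/-- The partial sums integrate a truncation of `e^{u_i}` against `e^{-∑ u_j}`, and the product is at
most 1. -/
lemma sum_tiltedMoment_single_le_one (h0 : ∀ᵐ u ∂μ, ∀ i, 0 ≤ u i) (i : Fin n) (N : ℕ) :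
    ∑ k ∈ Finset.range N, tiltedMoment μ (Pi.single i k) / (k.factorial : ℝ) ≤ 1 := by
  have hint : ∀ k : ℕ, Integrable (fun u : Fin n → ℝ =>
      (∏ j, (u j ^ (Pi.single i k : Fin n → ℕ) j * Real.exp (-u j))) / (k.factorial : ℝ)) μ :=
    fun k => (integrable_tilted_weight h0 _).div_const _
  simp_rw [tiltedMoment, ← integral_div]
  rw [← integral_finsetSum _ fun k _ => hint k]
  calc _ ≤ ∫ _, (1 : ℝ) ∂μ := by
        refine integral_mono_ae (integrable_finsetSum _ fun k _ => hint k) (integrable_const _) ?_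
        filter_upwards [h0] with u hu
        have h1 : ∀ k : ℕ, ∏ j, (u j ^ (Pi.single i k : Fin n → ℕ) j * Real.exp (-u j)) =
            u i ^ k * Real.exp (-∑ j, u j) := by
          intro k
          rw [Finset.prod_mul_distrib, ← Real.exp_sum, Finset.sum_neg_distrib,
            Finset.prod_eq_single i]
          · simp
          · intro j _ hj; simp [hj]
          · simp
        simp_rw [h1, mul_div_right_comm]
        rw [← Finset.sum_mul]
        calc _ ≤ Real.exp (u i) * Real.exp (-∑ j, u j) := by
              gcongr
              exact Real.sum_le_exp_of_nonneg (hu i) N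
          _ ≤ 1 := by
              rw [← Real.exp_add, Real.exp_le_one_iff]
              have := Finset.single_le_sum (fun j _ => hu j) (Finset.mem_univ i)
              linarith
    _ = 1 := by simp

lemma diag_lt_one_of_recursion (h0 : ∀ᵐ u ∂μ, ∀ i, 0 ≤ u i)
    (hnd : ∀ (v : Fin n → ℝ) (k : ℝ), (∀ᵐ u ∂μ, ∑ i, v i * u i = k) → v = 0)
    (hrec : ∀ y i, tiltedMoment μ (y + Pi.single i 1) =
      (H.mulVec (fun j => (y j : ℝ)) i + c i) * tiltedMoment μ y) (i : Fin n) : H i i < 1 := by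
  by_contra! hge
  have hd := diagonal_recursion h0 hnd hrec
  have hc := const_pos_of_recursion h0 hnd hrec i
  have hm := tiltedMoment_zero_pos μ h0
  set b := c i * tiltedMoment μ 0 with hb
  have hbpos : 0 < b := mul_pos hc hm
  -- The first term is `m(e_i) = b`; when `H i i ≥ 1`, each later term is at least `(k + 1)/(k + 2)`
  -- times its predecessor.
  have hlow : ∀ k : ℕ, b * (1 / ((k : ℝ) + 1)) ≤
      tiltedMoment μ (Pi.single i (k + 1)) / ((k + 1).factorial : ℝ) := by
    intro k
    induction k with
    | zero =>
      rw [single_recursion hd]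
      simp [hb]
    | succ k ih =>
      rw [single_recursion hd, Nat.factorial_succ (k + 1)]
      push_cast at ih ⊢
      have hk : ((k : ℝ) + 1) ≤ H i i * ((k : ℝ) + 1) + c i := by nlinarith
      calc b * (1 / ((k : ℝ) + 1 + 1))
          = ((k : ℝ) + 1) / ((k : ℝ) + 1 + 1) * (b * (1 / ((k : ℝ) + 1))) := by field_simp
        _ ≤ (H i i * ((k : ℝ) + 1) + c i) / ((k : ℝ) + 1 + 1) *
            (tiltedMoment μ (Pi.single i (k + 1)) / ((k + 1).factorial : ℝ)) := by gcongr
        _ = _ := by field_simp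
  have hbound : ∀ N : ℕ, b * ∑ k ∈ Finset.range N, 1 / ((k : ℝ) + 1) ≤ 1 := by
    intro N
    rw [Finset.mul_sum]
    refine (Finset.sum_le_sum fun k _ => hlow k).trans ?_
    refine le_trans ?_ (sum_tiltedMoment_single_le_one h0 i (N + 1))
    rw [Finset.sum_range_succ']
    simp [hm.le]
  obtain ⟨N, hN⟩ := (Filter.tendsto_atTop.1
    Real.tendsto_sum_range_one_div_nat_succ_atTop (1 / b + 1)).exists
  have h1 := hbound N
  have h2 : b * (1 / b + 1) ≤ b * ∑ k ∈ Finset.range N, 1 / ((k : ℝ) + 1) := by gcongr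
  have h3 : b * (1 / b + 1) = 1 + b := by field_simp
  linarith

/-- A non-degenerate law on the nonnegative orthant whose tilted moments satisfy an affine
recursion is a product of gamma laws. -/
lemma eq_pi_gamma_of_recursion (h0 : ∀ᵐ u ∂μ, ∀ i, 0 ≤ u i)
    (hnd : ∀ (v : Fin n → ℝ) (k : ℝ), (∀ᵐ u ∂μ, ∑ i, v i * u i = k) → v = 0)
    (hrec : ∀ y i, tiltedMoment μ (y + Pi.single i 1) =
      (H.mulVec (fun j => (y j : ℝ)) i + c i) * tiltedMoment μ y) :
    ∃ θ α : Fin n → ℝ, (∀ i, 0 < θ i ∧ 0 < α i) ∧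
      μ = Measure.pi fun i => gammaMeasure (α i) (θ i) := by
  have hpos := diag_pos_of_recursion h0 hnd hrec
  have hpar : ∀ i, 0 < 1 / H i i - 1 ∧ 0 < c i / H i i := fun i =>
    ⟨sub_pos.2 ((one_lt_div (hpos i)).2 (diag_lt_one_of_recursion h0 hnd hrec i)),
      div_pos (const_pos_of_recursion h0 hnd hrec i) (hpos i)⟩
  -- Obtained by solving `1/(1 + θ) = H i i` and `α/(1 + θ) = c i`.
  refine ⟨fun i => 1 / H i i - 1, fun i => c i / H i i, hpar, ?_⟩
  have := isProbabilityMeasure_pi_gamma hpar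
  refine ext_of_tiltedMoment h0 (ae_nonneg_pi_gamma hpar)
    (tiltedMoment_div_eq_of_recursion (tiltedMoment_zero_pos μ h0).ne'
      (tiltedMoment_pi_gamma_pos hpar 0).ne' (diagonal_recursion h0 hnd hrec) fun y i => ?_)
  rw [tiltedMoment_pi_gamma_add_single hpar]
  congr 1
  have := (hpos i).ne'
  field_simp
  ring

end Recursion

end PoissonLinear

end

/-! ### The characterization theorem -/

open PoissonLinear in
theorem theorem1 {Ω : Type*} [MeasurableSpace Ω] (P : MeasureTheory.Measure Ω)
    [MeasureTheory.IsProbabilityMeasure P] (n : ℕ)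
    (U : Ω → Fin n → ℝ) (Y : Ω → Fin n → ℕ)
    (hU : Measurable U) (hU0 : ∀ᵐ ω ∂P, ∀ i, 0 ≤ U ω i)
    (hY : PoissonLinear.IsPoissonOutput P U Y)
    (hnd : PoissonLinear.IsNondegenerate P U) :
    ((∃ (H : Matrix (Fin n) (Fin n) ℝ) (c : Fin n → ℝ),
        PoissonLinear.HasAffineCondMean P U Y H c) ↔
      ∃ θ α : Fin n → ℝ, PoissonLinear.HasProductGammaLaw P U θ α) ∧
    ∀ (H : Matrix (Fin n) (Fin n) ℝ) (c θ α : Fin n → ℝ),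
      PoissonLinear.HasAffineCondMean P U Y H c →
      PoissonLinear.HasProductGammaLaw P U θ α →
        (∀ y : Fin n → ℕ, P (Y ⁻¹' {y}) ≠ 0) ∧
        H = Matrix.diagonal (fun i => 1 / (1 + θ i)) ∧
        (∀ i, c i = α i * H i i ∧ c i = α i / (1 + θ i)) ∧
        ∀ i, 0 < H i i ∧ H i i < 1 ∧ 0 < c i := by
  have hprob : IsProbabilityMeasure (P.map U) := Measure.isProbabilityMeasure_map hU.aemeasurable
  have h0 : ∀ᵐ u ∂(P.map U), ∀ i, 0 ≤ u i :=
    (ae_map_iff hU.aemeasurable (by measurability)).2 hU0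
  have hint : ∀ i, Integrable (fun ω => U ω i) P := fun i => (hnd.1 i).integrable (by norm_num)
  have hndU : ∀ (v : Fin n → ℝ) (k : ℝ), (∀ᵐ u ∂(P.map U), ∑ i, v i * u i = k) → v = 0 :=
    fun v k hv => hnd.eq_zero_of_ae_const (ae_of_ae_map hU.aemeasurable hv)
  refine ⟨⟨?_, ?_⟩, ?_⟩
  · rintro ⟨H, c, h⟩
    obtain ⟨θ, α, hpos, hlaw⟩ := eq_pi_gamma_of_recursion h0 hndU
      ((hasAffineCondMean_iff hU hU0 hY hint H c).1 h)
    exact ⟨θ, α, hpos, hlaw⟩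
  · rintro ⟨θ, α, hpos, hlaw⟩
    refine ⟨Matrix.diagonal fun i => 1 / (1 + θ i), fun i => α i / (1 + θ i),
      (hasAffineCondMean_iff hU hU0 hY hint _ _).2 fun y i => ?_⟩
    rw [hlaw, tiltedMoment_pi_gamma_add_single hpos, Matrix.mulVec_diagonal]
    ring
  · rintro H c θ α h ⟨hpos, hlaw⟩
    have hrec := (hasAffineCondMean_iff hU hU0 hY hint H c).1 h
    have hne : ∀ y, tiltedMoment (P.map U) y ≠ 0 := fun y => by
      rw [hlaw]
      exact (tiltedMoment_pi_gamma_pos hpos y).ne'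
    -- No tilted moment vanishes, so the two recursions have equal coefficients at every `y`;
    -- evaluating at `0` and at `e_j` then reads off `c` and `H`.
    have hcoef : ∀ (y : Fin n → ℕ) i, H.mulVec (fun j => (y j : ℝ)) i + c i = (α i + y i) / (1 + θ i) := by
      intro y i
      have h1 := hrec y i
      have h2 := tiltedMoment_pi_gamma_add_single hpos y i
      rw [← hlaw, h1] at h2
      exact mul_right_cancel₀ (hne y) h2
    have hc : ∀ i, c i = α i / (1 + θ i) := by
      intro i
      have h1 := hcoef 0 i
      have h2 : (fun j => (((0 : Fin n → ℕ) j : ℕ) : ℝ)) = 0 := by ext; simp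
      rw [h2, Matrix.mulVec_zero] at h1
      simpa using h1
    have hH : H = Matrix.diagonal (fun i => 1 / (1 + θ i)) := by
      ext i j
      have h1 := hcoef (0 + Pi.single j 1) i
      rw [mulVec_natCast_add_single, add_right_comm, hcoef 0 i] at h1
      by_cases hij : i = j
      · subst hij
        rw [Matrix.diagonal_apply_eq]
        simp only [zero_add, Pi.zero_apply, Pi.single_eq_same, Nat.cast_zero, Nat.cast_one,
          add_zero, add_div] at h1
        linarith
      · rw [Matrix.diagonal_apply_ne _ hij]
        simpa [hij] using h1
    have hHii : ∀ i, H i i = 1 / (1 + θ i) := fun i => by rw [hH, Matrix.diagonal_apply_eq]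
    refine ⟨fun y => (prob_output_ne_zero_iff hU hU0 hY y).2 (hne y), hH, fun i => ⟨?_, hc i⟩,
      fun i => ?_⟩
    · rw [hc, hHii]; ring
    · have hθ := (hpos i).1
      have hα := (hpos i).2
      rw [hHii, hc]
      refine ⟨by positivity, ?_, by positivity⟩
      rw [div_lt_one (by positivity)]
      linarith
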